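/- Let $P$ be a finite set of points in the Euclidean plane and $K\ge 1$ an integer. For a point $u$ and $0\le j<K$ let $C_u^j$ be the cone consisting of the points $v\ne u$ such that the polar angle of the vector from $u$ to $v$ lies in $[2j\pi/K,\,2(j+1)\pi/K)$. A Yao graph $Y_K$ on $P$ is a directed graph obtained by choosing, for each $u\in P$ and each $j$ with $C_u^j\cap P\neq\emptyset$, a point $v\in C_u^j\cap P$ with $|uv|$ minimal and adding the edge $\overrightarrow{uv}$. A Yao-Yao (sparse-Yao) graph $YY_K$ on $P$ is obtained from a Yao graph $Y_K$ by choosing, for each $u\in P$ and each $j$ for which there is a point $v\in C_u^j\cap P$ with $\overrightarrow{vu}\in Y_K$, such a $v$ with $|uv|$ minimal and adding the edge $\overrightarrow{vu}$; edge directions are then forgotten. Ties are broken arbitrarily in both steps. A graph with vertex set $P$ is a geometric $t$-spanner if any $u,v\in P$ are joined by a path in it whose total Euclidean length is at most $t\,|uv|$. Put $\tau_K=\bigl(1-2\sin(\tfrac{\pi}{K}+\tfrac{\pi}{8})\bigr)^{-1}$. Theorem. There are constants $\tau'_k$ depending only on $k$, with $\tau'_k=\sqrt2+O(1/k)$ as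 $k\to\infty$, such that, with $t_k=\tau'_k\,\tau_{2k}$, for every integer $k\ge 42$ and every finite set $P$ of points in the plane, every Yao-Yao graph $YY_{2k}$ on $P$ is a geometric $t_k$-spanner. Moreover $$t_k=\sqrt2\,\bigl(1-2\sin(\pi/8)\bigr)^{-1}+O(1/k)\quad(k\to\infty),$$ where $\sqrt2\,(1-2\sin(\pi/8))^{-1}\approx 6.03$, i.e. it differs from $6.03$ by less than $0.005$. -/

import Mathlib

open scoped Real
open Filter Asymptotics

noncomputable section

namespace YaoYao

/-- The Euclidean plane. -/
abbrev Plane : Type := EuclideanSpace ℝ (Fin 2)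

/-- The cone with apex `u` formed by the (open) rays from `u` whose polar angles lie in
`[γ₁, γ₂)`. The apex itself has no polar angle and is not a member. -/
def cone (u : Plane) (γ₁ γ₂ : ℝ) : Set Plane :=
  {v | ∃ r : ℝ, 0 < r ∧ ∃ φ ∈ Set.Ico γ₁ γ₂,
    v 0 = u 0 + r * Real.cos φ ∧ v 1 = u 1 + r * Real.sin φ}

/-- The points of `P` in the `j`-th of the `K` equal cones with apex `u`. -/
def conePoints (K : ℕ) (P : Finset Plane) (u : P) (j : Fin K) : Set P :=
  {v | (v : Plane) ∈ cone u (2 * (j : ℝ) * π / K) (2 * ((j : ℝ) + 1) * π / K)}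

/-- `s` selects, for every point `u` and every index `j` with at least one candidate, a candidate
at the shortest distance from `u`. Ties are broken arbitrarily; where there is no
candidate, the value of `s` is irrelevant. -/
def IsNearestSelection {K : ℕ} {P : Finset Plane} (cand : P → Fin K → Set P)
    (s : P → Fin K → P) : Prop :=
  ∀ u j, (cand u j).Nonempty →
    s u j ∈ cand u j ∧ ∀ w ∈ cand u j, dist (u : Plane) (s u j) ≤ dist (u : Plane) w

/-- `Y` is (the directed edge relation of) a Yao graph `Y_K` on `P`, for some way of breaking ties:
`Y u v` says that the directed edge from `u` to `v` is present. -/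
def IsYaoGraph (K : ℕ) (P : Finset Plane) (Y : P → P → Prop) : Prop :=
  ∃ s : P → Fin K → P, IsNearestSelection (conePoints K P) s ∧
    ∀ u v, Y u v ↔ ∃ j, (conePoints K P u j).Nonempty ∧ v = s u j

/-- Candidates of the reverse Yao step at `u`: points `v` in the `j`-th cone at `u` such that
the directed edge from `v` to `u` is in `Y`. -/
def reverseCandidates (K : ℕ) (P : Finset Plane) (Y : P → P → Prop) (u : P) (j : Fin K) : Set P :=
  {v | v ∈ conePoints K P u j ∧ Y v u}

/-- `D` is (the directed edge relation of) the result of a reverse Yao step applied to `Y`. -/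
def IsReverseYaoStep (K : ℕ) (P : Finset Plane) (Y D : P → P → Prop) : Prop :=
  ∃ s : P → Fin K → P, IsNearestSelection (reverseCandidates K P Y) s ∧
    ∀ v u, D v u ↔ ∃ j, (reverseCandidates K P Y u j).Nonempty ∧ v = s u j

/-- `G` is a Yao-Yao graph `YY_K` on `P` (edge directions forgotten), for some way of breaking
ties in the two steps of its construction. -/
def IsYaoYaoGraph (K : ℕ) (P : Finset Plane) (G : SimpleGraph P) : Prop :=
  ∃ Y D : P → P → Prop, IsYaoGraph K P Y ∧ IsReverseYaoStep K P Y D ∧ G = SimpleGraph.fromRel D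

/-- Total Euclidean length of a walk. -/
def walkLength {P : Finset Plane} {G : SimpleGraph P} {u v : P} (p : G.Walk u v) : ℝ :=
  (p.darts.map fun d => dist (d.fst : Plane) (d.snd : Plane)).sum

/-- `G` is a geometric `t`-spanner of `P`. -/
def IsGeometricSpanner {P : Finset Plane} (G : SimpleGraph P) (t : ℝ) : Prop :=
  ∀ u v : P, ∃ p : G.Walk u v, p.IsPath ∧ walkLength p ≤ t * dist (u : Plane) (v : Plane)

/-- The constant `τ_K = (1 - 2 sin(π/K + π/8))⁻¹`. -/
def tau (K : ℕ) : ℝ := (1 - 2 * Real.sin (π / K + π / 8))⁻¹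

end YaoYao

end

/-!
Put `θ = π / k` and bound the distance in `G` between `u` and `v` by induction on `|uv|`. Let `x` be
a point nearest to `u` in a fan of about `k / 2` consecutive cones (a right angle) around the
direction of `v`. If `u` reaches `x` within `B * |ux|`, the law of cosines and induction on
`|xv| < |uv|` give a path of length at most `t * |uv|`, where `B = t * (1 - 2 sin(π/8 + 5θ/8))`.

The Yao step at `u` and the reverse Yao step at its head provide an edge `wx` of `G` with
`|wx| ≤ |ux|` whose tail `w` sees `x` from nearly the same direction as `u` does. It remains to join
`u` to `w`. Turn the plane so that the nearer side of the fan is horizontal. As `x` is nearest, no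
point lies below `u` in a corridor between `u` and `w`. Walk back from `w` to `u`, always to a
nearest point that is lower in the direction of `u` but not below `u`: a steep step is paid for by
the induction hypothesis and its loss of height, and a flat step is again an edge preceded by a
shorter corridor in the opposite direction. Such a walk costs at most `√2 * t + B` per unit of
height and `B` per unit of width. Each edge distorts height and width by `O(θ)` times its length,
which is affordable once `1 + √2 * t * θ ≤ B * (1 - 2 * θ)`, and the least such `t` tends to
`(1 - 2 sin(π/8))⁻¹` as `θ → 0`.
-/

noncomputable section

namespace YaoYao

open Real

/-! ### Walks of bounded length -/

section Walks

variable {P : Finset Plane} {G : SimpleGraph P} {u v w : P} {c d : ℝ}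

lemma walkLength_cons (h : G.Adj u v) (p : G.Walk v w) :
    walkLength (SimpleGraph.Walk.cons h p) = dist (u : Plane) v + walkLength p := by
  simp [walkLength]

lemma walkLength_append (p : G.Walk u v) (q : G.Walk v w) :
    walkLength (p.append q) = walkLength p + walkLength q := by
  simp [walkLength]

lemma walkLength_reverse (p : G.Walk u v) : walkLength p.reverse = walkLength p := by
  simp only [walkLength, SimpleGraph.Walk.darts_reverse, List.map_reverse, List.sum_reverse,
    List.map_map]
  exact congrArg List.sum (List.map_congr_left fun d _ => by simp [dist_comm])

lemma walkLength_nonneg (p : G.Walk u v) : 0 ≤ walkLength p := by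
  refine List.sum_nonneg fun x hx => ?_
  obtain ⟨d, -, rfl⟩ := List.mem_map.1 hx
  exact dist_nonneg

lemma walkLength_dropUntil_le [DecidableEq P] (p : G.Walk u v) (h : w ∈ p.support) :
    walkLength (p.dropUntil w h) ≤ walkLength p := by
  have hsplit := walkLength_append (p.takeUntil w h) (p.dropUntil w h)
  rw [SimpleGraph.Walk.take_spec] at hsplit
  linarith [walkLength_nonneg (p.takeUntil w h)]

lemma walkLength_bypass_le [DecidableEq P] (p : G.Walk u v) :
    walkLength p.bypass ≤ walkLength p := by
  induction p with
  | nil => exact le_rfl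
  | @cons u v w h p ih =>
    have hd : 0 ≤ dist (u : Plane) v := dist_nonneg
    rw [SimpleGraph.Walk.bypass, walkLength_cons]
    split_ifs with hs
    · linarith [walkLength_dropUntil_le p.bypass hs]
    · rw [walkLength_cons]
      linarith

/-- `u` and `v` are joined by a walk of length at most `c`; walks, unlike paths, can be
concatenated freely. -/
def ReachableWithin (G : SimpleGraph P) (u v : P) (c : ℝ) : Prop :=
  ∃ p : G.Walk u v, walkLength p ≤ c

lemma ReachableWithin.exists_isPath (h : ReachableWithin G u v c) :
    ∃ p : G.Walk u v, p.IsPath ∧ walkLength p ≤ c := by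
  classical
  obtain ⟨p, hp⟩ := h
  exact ⟨p.bypass, p.bypass_isPath, (walkLength_bypass_le p).trans hp⟩

lemma ReachableWithin.refl (u : P) : ReachableWithin G u u 0 :=
  ⟨SimpleGraph.Walk.nil, by simp [walkLength]⟩

lemma ReachableWithin.symm (h : ReachableWithin G u v c) : ReachableWithin G v u c := by
  obtain ⟨p, hp⟩ := h
  exact ⟨p.reverse, (walkLength_reverse p).trans_le hp⟩

lemma ReachableWithin.trans (h : ReachableWithin G u v c) (h' : ReachableWithin G v w d) :
    ReachableWithin G u w (c + d) := by
  obtain ⟨p, hp⟩ := h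
  obtain ⟨q, hq⟩ := h'
  exact ⟨p.append q, (walkLength_append p q).trans_le (add_le_add hp hq)⟩

lemma ReachableWithin.mono (h : ReachableWithin G u v c) (hcd : c ≤ d) :
    ReachableWithin G u v d :=
  h.imp fun _ hp => hp.trans hcd

lemma ReachableWithin.of_adj (h : G.Adj u v) : ReachableWithin G u v (dist (u : Plane) v) :=
  ⟨SimpleGraph.Walk.cons h SimpleGraph.Walk.nil, by simp [walkLength]⟩

/-- The spanner inequality with ratio `t` for all pairs at distance less than `ρ`: the induction
hypothesis when distances are treated in increasing order. -/
def IsLocalSpanner (G : SimpleGraph P) (t ρ : ℝ) : Prop :=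
  ∀ u v : P, dist (u : Plane) v < ρ → ReachableWithin G u v (t * dist (u : Plane) v)

end Walks

lemma induction_on_lt {α β : Type*} [Finite α] [Preorder β] (f : α → β) {p : α → Prop}
    (step : ∀ a, (∀ a', f a' < f a → p a') → p a) (a : α) : p a := by
  have : IsTrans α (InvImage (· < ·) f) := ⟨fun _ _ _ => lt_trans⟩
  have : Std.Irrefl (InvImage (· < ·) f) := ⟨fun a => lt_irrefl (f a)⟩
  exact (Finite.wellFounded_of_trans_of_irrefl (InvImage (· < ·) f)).induction a step

lemma isGeometricSpanner_of_isLocalSpanner {P : Finset Plane} {G : SimpleGraph P} {t : ℝ}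
    (step : ∀ u v : P, IsLocalSpanner G t (dist (u : Plane) v) →
      ReachableWithin G u v (t * dist (u : Plane) v)) : IsGeometricSpanner G t := by
  have h : ∀ e : P × P, ReachableWithin G e.1 e.2 (t * dist (e.1 : Plane) e.2) :=
    induction_on_lt (fun e : P × P => dist (e.1 : Plane) e.2) fun e ih =>
      step e.1 e.2 fun p q => ih (p, q)
  exact fun u v => (h (u, v)).exists_isPath

/-! ### Triangles in polar coordinates -/

lemma polar_sub_sq (l r x y : ℝ) :
    (l * cos x - r * cos y) ^ 2 + (l * sin x - r * sin y) ^ 2 =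
      l ^ 2 + r ^ 2 - 2 * l * r * cos (x - y) := by
  rw [cos_sub]
  linear_combination l ^ 2 * sin_sq_add_cos_sq x + r ^ 2 * sin_sq_add_cos_sq y

lemma polar_sub_sq_lt {l r x y : ℝ} (hr : 0 < r) (hrl : r ≤ l) (hxy : |x - y| < π / 3) :
    (l * cos x - r * cos y) ^ 2 + (l * sin x - r * sin y) ^ 2 < l ^ 2 := by
  have hcos : 1 / 2 < cos (x - y) := by
    rw [← cos_pi_div_three, ← cos_abs (x - y)]
    exact cos_lt_cos_of_nonneg_of_le_pi (abs_nonneg _) (by linarith [pi_pos]) hxy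
  rw [polar_sub_sq]
  nlinarith [mul_pos (hr.trans_le hrl) hr]

/-- The component of the third side along `x` is `a = l - r * cos (x - y) ≥ 0` and the one across
is `s = r * sin (x - y)`; the hypothesis `h` says `a * cos x ≤ s * sin x`, so that `a` is
controlled by `s`. -/
lemma polar_sub_sq_mul_cos_sq_le {l r x y : ℝ} (hr : 0 ≤ r) (hrl : r ≤ l) (hx : 0 ≤ cos x)
    (h : l * cos x ≤ r * cos y) :
    ((l * cos x - r * cos y) ^ 2 + (l * sin x - r * sin y) ^ 2) * cos x ^ 2 ≤
      (r * sin (x - y)) ^ 2 := by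
  have ha : 0 ≤ l - r * cos (x - y) := by nlinarith [cos_le_one (x - y)]
  have hy : cos y = cos x * cos (x - y) + sin x * sin (x - y) := by
    rw [← cos_sub, sub_sub_cancel]
  have hle : (l - r * cos (x - y)) * cos x ≤ r * sin (x - y) * sin x := by
    rw [hy] at h
    linarith
  have hsq := pow_le_pow_left₀ (mul_nonneg ha hx) hle 2
  rw [polar_sub_sq]
  linear_combination hsq + (r * sin (x - y)) ^ 2 * sin_sq_add_cos_sq x -
    r ^ 2 * cos x ^ 2 * sin_sq_add_cos_sq (x - y)

lemma law_of_cosines_le {l m δ α d : ℝ} (hl : 0 ≤ l) (hlm : l ≤ m) (hα : α ≤ π) (hδ : |δ| ≤ α)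
    (hd : d ^ 2 = l ^ 2 + m ^ 2 - 2 * l * m * cos δ) :
    d ≤ m - l * (1 - 2 * sin (α / 2)) := by
  obtain ⟨s, hs⟩ : ∃ s, s = sin (|δ| / 2) := ⟨_, rfl⟩
  have hs0 : 0 ≤ s :=
    hs ▸ sin_nonneg_of_nonneg_of_le_pi (by positivity) (by linarith [abs_nonneg δ])
  have hs1 : s ≤ 1 := hs ▸ sin_le_one _
  have hsα : s ≤ sin (α / 2) :=
    hs ▸ sin_le_sin_of_le_of_le_pi_div_two (by linarith [abs_nonneg δ, pi_pos]) (by linarith)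
      (by linarith)
  have hcos : cos δ = 1 - 2 * s ^ 2 := by
    have h2 := cos_two_mul (|δ| / 2)
    rw [mul_div_cancel₀ _ two_ne_zero, cos_abs] at h2
    rw [hs]
    linear_combination h2 + 2 * sin_sq_add_cos_sq (|δ| / 2)
  have hle : d ≤ m - l + 2 * l * s := by
    refine le_of_sq_le_sq ?_ (by nlinarith)
    have : 0 ≤ l * s * ((m - l) * (1 - s)) :=
      mul_nonneg (mul_nonneg hl hs0) (mul_nonneg (sub_nonneg.2 hlm) (sub_nonneg.2 hs1))
    rw [hd, hcos]
    linarith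
  linarith [mul_le_mul_of_nonneg_left hsα hl]

lemma one_le_cos_add_sin {x : ℝ} (h0 : 0 ≤ x) (h1 : x ≤ π / 2) : 1 ≤ cos x + sin x := by
  have hc := cos_nonneg_of_neg_pi_div_two_le_of_le (by linarith) h1
  have hs := sin_nonneg_of_nonneg_of_le_pi h0 (by linarith [pi_pos])
  nlinarith [sin_sq_add_cos_sq x, mul_nonneg hc hs]

lemma le_sqrt_two_mul_of_sq_le {d y : ℝ} (hy : 0 ≤ y) (h : d ^ 2 ≤ 2 * y ^ 2) : d ≤ √2 * y := by
  refine le_of_sq_le_sq ?_ (by positivity)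
  rwa [mul_pow, sq_sqrt zero_le_two]

/-! ### Frames -/

/-- `x < y` for `b = true` and `x ≤ y` for `b = false`. Half-open cones contain one of their two
sides; which of the two it is depends on the direction `b` from which the cone is described. -/
def LtOrLe (b : Bool) (x y : ℝ) : Prop := if b then x < y else x ≤ y

section LtOrLe

variable {b : Bool} {x y z : ℝ}

lemma LtOrLe.le (h : LtOrLe b x y) : x ≤ y := by
  cases b
  · exact h
  · exact le_of_lt h

lemma LtOrLe.of_lt (h : x < y) : LtOrLe b x y := by
  cases b
  · exact h.le
  · exact h

lemma not_ltOrLe : ¬ LtOrLe b x y ↔ LtOrLe (!b) y x := by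
  cases b <;> simp [LtOrLe]

lemma LtOrLe.trans_le (h : LtOrLe b x y) (h' : y ≤ z) : LtOrLe b x z := by
  cases b
  · exact le_trans h h'
  · exact lt_of_lt_of_le h h'

lemma le_trans_ltOrLe (h : x ≤ y) (h' : LtOrLe b y z) : LtOrLe b x z := by
  cases b
  · exact le_trans h h'
  · exact lt_of_le_of_lt h h'

lemma LtOrLe.trans_not (h : LtOrLe b x y) (h' : LtOrLe (!b) y z) : x < z := by
  cases b
  · exact lt_of_le_of_lt h h'
  · exact lt_of_lt_of_le h h'

lemma exists_int_mul_ltOrLe (b : Bool) {θ : ℝ} (hθ : 0 < θ) (x : ℝ) :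
    ∃ i : ℤ, LtOrLe b (i * θ) x ∧ LtOrLe (!b) x ((i + 1) * θ) := by
  cases b
  · refine ⟨⌊x / θ⌋, ?_, ?_⟩
    · exact (le_div_iff₀ hθ).1 (Int.floor_le _)
    · exact (div_lt_iff₀ hθ).1 (Int.lt_floor_add_one _)
  · refine ⟨⌈x / θ⌉ - 1, ?_, ?_⟩
    · have := (lt_div_iff₀ hθ).1 (sub_lt_iff_lt_add.2 (Int.ceil_lt_add_one (x / θ)))
      exact_mod_cast this
    · have := (div_le_iff₀ hθ).1 (Int.le_ceil (x / θ))
      simpa [LtOrLe] using this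

end LtOrLe

/-- Horizontal distance travelled from `u` to `v` in the frame rotated by `ω`, counted positively
to the right for `b = true` and to the left for `b = false`. -/
def advance (ω : ℝ) (b : Bool) (u v : Plane) : ℝ :=
  (if b then 1 else -1) * ((v 0 - u 0) * cos ω + (v 1 - u 1) * sin ω)

/-- Height lost from `u` to `v` in the frame rotated by `ω`. -/
def drop (ω : ℝ) (u v : Plane) : ℝ := (v 0 - u 0) * sin ω - (v 1 - u 1) * cos ω

/-- `v` is lower than `u` in the frame rotated by `ω`, strictly for `b = true` and weakly for
`b = false`. -/
def Below (ω : ℝ) (b : Bool) (u v : Plane) : Prop := LtOrLe b 0 (drop ω u v)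

/-- The angle, in `(-π, π]`, at which one descends from `u` to `v` in the frame rotated by `ω` when
facing the direction `b`. -/
def descentAngle (ω : ℝ) (b : Bool) (u v : Plane) : ℝ :=
  Complex.arg ⟨advance ω b u v, drop ω u v⟩

/-- The polar angle of the ray that descends at the angle `χ` in the frame rotated by `ω`, facing
the direction `b`. -/
def descentRay (ω : ℝ) (b : Bool) (χ : ℝ) : ℝ := if b then ω - χ else ω + π + χ

/-- The cone at `u` of the rays that descend at an angle between `α` and `β` in the frame rotated by
`ω`, facing the direction `b`; its boundary is treated as in `cone`. -/
def descendingCone (ω : ℝ) (b : Bool) (u : Plane) (α β : ℝ) : Set Plane :=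
  if b then cone u (ω - β) (ω - α) else cone u (ω + π + α) (ω + π + β)

section Frame

variable {ω : ℝ} {b : Bool} {u v w x z : Plane}

lemma advance_sub (ω : ℝ) (b : Bool) (u v w : Plane) :
    advance ω b u v - advance ω b u w = advance ω b w v := by
  simp only [advance]
  ring

lemma advance_self (ω : ℝ) (b : Bool) (u : Plane) : advance ω b u u = 0 := by
  simp [advance]

lemma advance_not (ω : ℝ) (b : Bool) (u v w : Plane) :
    advance ω (!b) v w = advance ω b u v - advance ω b u w := by
  cases b <;> simp only [advance, Bool.not_true, Bool.not_false, if_true, if_false,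
    Bool.false_eq_true] <;> ring

lemma drop_sub (ω : ℝ) (u v w : Plane) : drop ω u v - drop ω u w = drop ω w v := by
  simp only [drop]
  ring

lemma drop_self (ω : ℝ) (u : Plane) : drop ω u u = 0 := by
  simp [drop]

lemma drop_swap (ω : ℝ) (u v : Plane) : drop ω v u = -drop ω u v := by
  simp only [drop]
  ring

lemma dist_sq (u v : Plane) : dist u v ^ 2 = (v 0 - u 0) ^ 2 + (v 1 - u 1) ^ 2 := by
  rw [dist_comm, EuclideanSpace.dist_eq, sq_sqrt (by positivity), Fin.sum_univ_two, Real.dist_eq,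
    Real.dist_eq, sq_abs, sq_abs]

lemma dist_sq_eq_advance_sq_add_drop_sq (ω : ℝ) (b : Bool) (u v : Plane) :
    dist u v ^ 2 = advance ω b u v ^ 2 + drop ω u v ^ 2 := by
  have hsq : (if b then 1 else -1 : ℝ) ^ 2 = 1 := by cases b <;> norm_num
  rw [dist_sq, advance, drop, mul_pow, hsq]
  linear_combination (-((v 0 - u 0) ^ 2 + (v 1 - u 1) ^ 2)) * sin_sq_add_cos_sq ω

lemma dist_le_dist_iff (ω : ℝ) (b : Bool) (u v w : Plane) :
    dist w v ≤ dist w u ↔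
      dist u v ^ 2 ≤ 2 * (advance ω b u w * advance ω b u v + drop ω u w * drop ω u v) := by
  rw [← pow_le_pow_iff_left₀ dist_nonneg dist_nonneg two_ne_zero, dist_comm w u,
    dist_sq_eq_advance_sq_add_drop_sq ω b w v, dist_sq_eq_advance_sq_add_drop_sq ω b u w,
    dist_sq_eq_advance_sq_add_drop_sq ω b u v, ← advance_sub ω b u v w, ← drop_sub ω u v w]
  constructor <;> intro h <;> linarith

lemma dist_le_of_advance_le_of_drop_le (ω : ℝ) (b b' : Bool)
    (ha : |advance ω b u v| ≤ |advance ω b' w z|) (hd : |drop ω u v| ≤ |drop ω w z|) :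
    dist u v ≤ dist w z := by
  refine le_of_sq_le_sq ?_ dist_nonneg
  rw [dist_sq_eq_advance_sq_add_drop_sq ω b, dist_sq_eq_advance_sq_add_drop_sq ω b' w]
  exact add_le_add (sq_le_sq.2 ha) (sq_le_sq.2 hd)

lemma Below.drop_nonneg (h : Below ω b u v) : 0 ≤ drop ω u v := LtOrLe.le h

lemma not_below_iff : ¬ Below ω b u v ↔ Below ω (!b) v u := by
  rw [Below, not_ltOrLe, Below, drop_swap]
  cases b <;> simp [LtOrLe]

lemma drop_nonpos_of_not_below (h : ¬ Below ω b u v) : drop ω u v ≤ 0 := by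
  linarith [(not_below_iff.1 h).drop_nonneg, drop_swap ω u v]

lemma Below.trans (h : Below ω b u v) (h' : 0 ≤ drop ω v w) : Below ω b u w :=
  LtOrLe.trans_le h (by linarith [drop_sub ω u w v])

lemma norm_advance_drop (ω : ℝ) (b : Bool) (u v : Plane) :
    ‖(⟨advance ω b u v, drop ω u v⟩ : ℂ)‖ = dist u v := by
  refine (pow_left_inj₀ (norm_nonneg _) dist_nonneg two_ne_zero).1 ?_
  rw [dist_sq_eq_advance_sq_add_drop_sq ω b, ← Complex.normSq_eq_norm_sq, Complex.normSq_apply]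
  ring

lemma dist_mul_cos_descentAngle (ω : ℝ) (b : Bool) (u v : Plane) :
    dist u v * cos (descentAngle ω b u v) = advance ω b u v := by
  rw [← norm_advance_drop ω b, descentAngle, Complex.norm_mul_cos_arg]

lemma dist_mul_sin_descentAngle (ω : ℝ) (b : Bool) (u v : Plane) :
    dist u v * sin (descentAngle ω b u v) = drop ω u v := by
  rw [← norm_advance_drop ω b, descentAngle, Complex.norm_mul_sin_arg]

lemma dist_sq_of_common_apex (ω : ℝ) (b : Bool) (u v w : Plane) :
    dist v w ^ 2 =
      (dist u w * cos (descentAngle ω b u w) - dist u v * cos (descentAngle ω b u v)) ^ 2 +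
      (dist u w * sin (descentAngle ω b u w) - dist u v * sin (descentAngle ω b u v)) ^ 2 := by
  simp only [dist_mul_cos_descentAngle, dist_mul_sin_descentAngle, advance_sub, drop_sub]
  exact dist_sq_eq_advance_sq_add_drop_sq ω b v w

lemma dist_sq_of_common_head (ω : ℝ) (b : Bool) (u v w : Plane) :
    dist u v ^ 2 =
      (dist u w * cos (descentAngle ω b u w) - dist v w * cos (descentAngle ω b v w)) ^ 2 +
      (dist u w * sin (descentAngle ω b u w) - dist v w * sin (descentAngle ω b v w)) ^ 2 := by
  simp only [dist_mul_cos_descentAngle, dist_mul_sin_descentAngle, ← advance_sub ω b u w v,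
    ← drop_sub ω u w v, sub_sub_cancel]
  exact dist_sq_eq_advance_sq_add_drop_sq ω b u v

lemma descentAngle_eq_of_polar {r χ : ℝ} (hr : 0 < r) (hχ : χ ∈ Set.Ioc (-π) π)
    (ha : advance ω b u v = r * cos χ) (hd : drop ω u v = r * sin χ) :
    descentAngle ω b u v = χ := by
  rw [← Complex.arg_mul_cos_add_sin_mul_I hr hχ, descentAngle, ha, hd]
  refine congrArg Complex.arg (Complex.ext ?_ ?_) <;>
  simp [Complex.cos_ofReal_re, Complex.sin_ofReal_re, Complex.cos_ofReal_im, Complex.sin_ofReal_im]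

lemma descentAngle_nonneg (h : 0 ≤ drop ω u v) : 0 ≤ descentAngle ω b u v :=
  Complex.arg_nonneg_iff.2 h

lemma abs_descentAngle_lt_pi_div_two (h : 0 < advance ω b u v) :
    |descentAngle ω b u v| < π / 2 :=
  Complex.abs_arg_lt_pi_div_two_iff.2 (Or.inl h)

lemma descentAngle_le_pi_div_four (ha : 0 < advance ω b u v) (hd : drop ω u v ≤ advance ω b u v) :
    descentAngle ω b u v ≤ π / 4 := by
  obtain ⟨h0, h1⟩ := abs_lt.1 (abs_descentAngle_lt_pi_div_two ha)
  by_contra! hlt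
  rw [← dist_mul_cos_descentAngle] at ha
  rw [← dist_mul_sin_descentAngle ω b, ← dist_mul_cos_descentAngle ω b] at hd
  have hsc := le_of_mul_le_mul_left hd
    (pos_of_mul_pos_left ha (cos_nonneg_of_neg_pi_div_two_le_of_le h0.le h1.le))
  have hcs : cos (descentAngle ω b u v) < cos (π / 2 - descentAngle ω b u v) :=
    cos_lt_cos_of_nonneg_of_le_pi (by linarith) (by linarith) (by linarith)
  rw [cos_pi_div_two_sub] at hcs
  exact hsc.not_gt hcs

lemma Below.ltOrLe_descentAngle (ha : 0 < advance ω b u v) (h : Below ω b u v) :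
    LtOrLe b 0 (descentAngle ω b u v) := by
  cases b
  · exact descentAngle_nonneg h.drop_nonneg
  · refine lt_of_le_of_ne (descentAngle_nonneg h.drop_nonneg) fun h0 => ?_
    have hd := dist_mul_sin_descentAngle ω true u v
    rw [← h0, sin_zero, mul_zero] at hd
    exact absurd h (by simp [Below, LtOrLe, ← hd])

lemma below_of_ltOrLe_descentAngle (huv : u ≠ v) (h0 : LtOrLe b 0 (descentAngle ω b u v))
    (h1 : descentAngle ω b u v < π) : Below ω b u v := by
  have hpos := dist_pos.2 huv
  rw [Below, ← dist_mul_sin_descentAngle ω b]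
  cases b
  · exact mul_nonneg hpos.le (sin_nonneg_of_nonneg_of_le_pi h0 h1.le)
  · exact mul_pos hpos (sin_pos_of_pos_of_lt_pi h0 h1)

lemma advance_drop_of_polar {r χ : ℝ} (h0 : v 0 = u 0 + r * cos (descentRay ω b χ))
    (h1 : v 1 = u 1 + r * sin (descentRay ω b χ)) :
    advance ω b u v = r * cos χ ∧ drop ω u v = r * sin χ := by
  have hω := sin_sq_add_cos_sq ω
  cases b
  · rw [descentRay, if_neg Bool.false_ne_true, add_right_comm] at h0 h1
    rw [cos_add_pi, cos_add] at h0
    rw [sin_add_pi, sin_add] at h1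
    simp only [advance, drop, h0, h1, Bool.false_eq_true, if_false]
    exact ⟨by linear_combination r * cos χ * hω, by linear_combination r * sin χ * hω⟩
  · rw [descentRay, if_pos rfl] at h0 h1
    rw [cos_sub] at h0
    rw [sin_sub] at h1
    simp only [advance, drop, h0, h1, if_true]
    exact ⟨by linear_combination r * cos χ * hω, by linear_combination r * sin χ * hω⟩

lemma polar_descentAngle (ω : ℝ) (b : Bool) (u v : Plane) :
    v 0 = u 0 + dist u v * cos (descentRay ω b (descentAngle ω b u v)) ∧
      v 1 = u 1 + dist u v * sin (descentRay ω b (descentAngle ω b u v)) := by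
  have ha := dist_mul_cos_descentAngle ω b u v
  have hd := dist_mul_sin_descentAngle ω b u v
  have hω := sin_sq_add_cos_sq ω
  cases b
  · rw [advance, if_neg Bool.false_ne_true] at ha
    rw [drop] at hd
    rw [descentRay, if_neg Bool.false_ne_true, add_right_comm, cos_add_pi, cos_add, sin_add_pi,
      sin_add]
    constructor
    · linear_combination (u 0 - v 0) * hω + cos ω * ha - sin ω * hd
    · linear_combination (u 1 - v 1) * hω + sin ω * ha + cos ω * hd
  · rw [advance, if_pos rfl] at ha
    rw [drop] at hd
    rw [descentRay, if_pos rfl, cos_sub, sin_sub]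
    constructor
    · linear_combination (u 0 - v 0) * hω - cos ω * ha - sin ω * hd
    · linear_combination (u 1 - v 1) * hω - sin ω * ha + cos ω * hd

lemma mem_descendingCone_iff_polar {α β : ℝ} :
    v ∈ descendingCone ω b u α β ↔ ∃ r, 0 < r ∧ ∃ χ, LtOrLe b α χ ∧ LtOrLe (!b) χ β ∧
      v 0 = u 0 + r * cos (descentRay ω b χ) ∧ v 1 = u 1 + r * sin (descentRay ω b χ) := by
  cases b
  · constructor
    · rintro ⟨r, hr, φ, ⟨h1, h2⟩, h⟩
      refine ⟨r, hr, φ - (ω + π), le_sub_iff_add_le'.2 h1, sub_lt_iff_lt_add'.2 h2, ?_⟩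
      simpa only [descentRay, Bool.false_eq_true, if_false, add_sub_cancel] using h
    · rintro ⟨r, hr, χ, h1, h2, h⟩
      exact ⟨r, hr, ω + π + χ, ⟨add_le_add_right h1 _, add_lt_add_right h2 _⟩, h⟩
  · constructor
    · rintro ⟨r, hr, φ, ⟨h1, h2⟩, h⟩
      refine ⟨r, hr, ω - φ, lt_sub_comm.1 h2, sub_le_comm.1 h1, ?_⟩
      simpa only [descentRay, if_true, sub_sub_cancel] using h
    · rintro ⟨r, hr, χ, h1, h2, h⟩
      exact ⟨r, hr, ω - χ, ⟨sub_le_sub_left h2 _, sub_lt_sub_left h1 _⟩, h⟩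

lemma mem_descendingCone_iff {α β : ℝ} (hα : 0 ≤ α) (hβ : β ≤ π) :
    v ∈ descendingCone ω b u α β ↔
      u ≠ v ∧ LtOrLe b α (descentAngle ω b u v) ∧ LtOrLe (!b) (descentAngle ω b u v) β := by
  rw [mem_descendingCone_iff_polar]
  constructor
  · rintro ⟨r, hr, χ, h1, h2, h⟩
    obtain ⟨ha, hd⟩ := advance_drop_of_polar h.1 h.2
    have hχ : χ ∈ Set.Ioc (-π) π := ⟨by linarith [h1.le, pi_pos], h2.le.trans hβ⟩
    rw [descentAngle_eq_of_polar hr hχ ha hd]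
    refine ⟨?_, h1, h2⟩
    rintro rfl
    rw [advance_self] at ha
    rw [drop_self] at hd
    nlinarith [sin_sq_add_cos_sq χ, pow_pos hr 2]
  · rintro ⟨huv, h1, h2⟩
    exact ⟨dist u v, dist_pos.2 huv, _, h1, h2, polar_descentAngle ω b u v⟩

end Frame

/-! ### Hops -/

/-- The width price `B` is large enough, compared with the ratio `t` and the cone angle `θ`, to pay
for an edge of unit length together with the errors of size `θ` that it causes in height and
width. The height price that goes with it is `√2 * t + B`. -/
structure IsAdmissible (θ t B : ℝ) : Prop where
  nonneg : 0 ≤ θ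
  lt_pi_div_twelve : θ < π / 12
  pos : 0 < t
  edge_le : 1 + √2 * t * θ ≤ B * (1 - 2 * θ)

section Prices

variable {θ t B : ℝ}

lemma IsAdmissible.width_pos (h : IsAdmissible θ t B) : 0 < B := by
  have h1 := h.lt_pi_div_twelve
  have h2 : 0 ≤ √2 * t * θ := mul_nonneg (mul_nonneg (sqrt_nonneg 2) h.pos.le) h.nonneg
  exact pos_of_mul_pos_left (by linarith [h.edge_le]) (by linarith [pi_lt_four] : 0 ≤ 1 - 2 * θ)

lemma IsAdmissible.width_le (h : IsAdmissible θ t B) : B ≤ √2 * t + B :=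
  le_add_of_nonneg_left (mul_nonneg (sqrt_nonneg 2) h.pos.le)

lemma IsAdmissible.le_mul_cos (h : IsAdmissible θ t B) {χ : ℝ} (h0 : 0 ≤ χ) (h1 : χ ≤ π / 4 + θ) :
    t ≤ (√2 * t + B) * cos χ := by
  have hB := h.width_pos
  have hs : √2 * √2 = 2 := mul_self_sqrt zero_le_two
  have hθ := h.nonneg
  have hcos : √2 / 2 * (1 - θ - θ ^ 2 / 2) ≤ cos χ := by
    refine le_trans ?_ (cos_le_cos_of_nonneg_of_le_pi h0
      (by linarith [h.lt_pi_div_twelve, pi_pos]) h1)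
    rw [cos_add, cos_pi_div_four, sin_pi_div_four, ← mul_sub]
    exact mul_le_mul_of_nonneg_left (by linarith [one_sub_sq_div_two_le_cos (x := θ), sin_le hθ])
      (by positivity)
  have hedge : √2 * t * θ * (1 + θ / 2) ≤ B * (1 - 2 * θ) * (1 + θ / 2) :=
    mul_le_mul_of_nonneg_right (by linarith [h.edge_le]) (by positivity)
  refine le_trans ?_ (mul_le_mul_of_nonneg_left hcos (h.width_pos.le.trans h.width_le))
  have hBθ : 0 ≤ B * θ * (1 + θ) := by positivity
  have key : 0 ≤ √2 / 2 * (B * (1 - θ - θ ^ 2 / 2) - √2 * t * θ * (1 + θ / 2)) :=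
    mul_nonneg (by positivity) (by linarith)
  linear_combination key - t / 2 * hs

/-- The length that we allow for a walk from `u` to `w` when every unit of height gained costs
`√2 * t + B` and every unit of width costs `B`. -/
def cost (ω t B : ℝ) (b : Bool) (u w : Plane) : ℝ :=
  B * advance ω b u w - (√2 * t + B) * drop ω u w

lemma cost_self (ω t B : ℝ) (b : Bool) (u : Plane) : cost ω t B b u u = 0 := by
  rw [cost, advance_self, drop_self, mul_zero, mul_zero, sub_zero]

lemma cost_add (ω t B : ℝ) (b : Bool) (u v w : Plane) :
    cost ω t B b u v + cost ω t B b v w = cost ω t B b u w := by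
  rw [cost, cost, cost, ← advance_sub ω b u w v, ← drop_sub ω u w v]
  ring

end Prices

/-- `x` is reached from `z` by descending, facing `b`, at a moderate angle; and `x` is the head of
an edge from a point `w` that is no farther from `x` than `z` is and descends to `x` at nearly the
same angle. -/
structure IsHop {P : Finset Plane} (G : SimpleGraph P) (ω θ : ℝ) (b : Bool) (z x w : P) :
    Prop where
  adj : G.Adj w x
  dist_le : dist (w : Plane) x ≤ dist (z : Plane) x
  angle_nonneg : 0 ≤ descentAngle ω b z x
  angle_le : descentAngle ω b z x ≤ π / 4 + θ
  abs_angle_sub_le : |descentAngle ω b z x - descentAngle ω b w x| ≤ θ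
  below : Below ω b z x
  back_below : Below ω b w x

section Hop

variable {P : Finset Plane} {G : SimpleGraph P} {ω θ t B ρ : ℝ} {b : Bool} {z x w : P}

lemma IsHop.edge_pos (h : IsHop G ω θ b z x w) : 0 < dist (w : Plane) x :=
  dist_pos.2 fun hwx => h.adj.ne (Subtype.ext hwx)

lemma IsHop.dist_pos (h : IsHop G ω θ b z x w) : 0 < dist (z : Plane) x :=
  h.edge_pos.trans_le h.dist_le

lemma IsHop.dist_lt (h : IsHop G ω θ b z x w) (hθ : θ < π / 12) :
    dist (z : Plane) w < dist (z : Plane) x := by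
  refine lt_of_pow_lt_pow_left₀ 2 dist_nonneg ?_
  rw [dist_sq_of_common_head ω b z w x]
  exact polar_sub_sq_lt h.edge_pos h.dist_le
    (h.abs_angle_sub_le.trans_lt (by linarith [pi_pos]))

lemma IsHop.cos_pos (h : IsHop G ω θ b z x w) (hθ : θ < π / 12) :
    0 < cos (descentAngle ω b z x) :=
  cos_pos_of_mem_Ioo
    ⟨by linarith [h.angle_nonneg, pi_pos], by linarith [h.angle_le, pi_pos]⟩

lemma IsHop.sin_nonneg (h : IsHop G ω θ b z x w) : 0 ≤ sin (descentAngle ω b z x) :=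
  sin_nonneg_of_nonneg_of_le_pi h.angle_nonneg (Complex.arg_le_pi _)

lemma IsHop.advance_pos (h : IsHop G ω θ b z x w) (hθ : θ < π / 12) : 0 < advance ω b z x := by
  rw [← dist_mul_cos_descentAngle]
  exact mul_pos h.dist_pos (h.cos_pos hθ)

/-- When `w` is behind `z`, the segment `zw` is as short as `O(θ)` times the edge, so the induction
hypothesis pays for it. -/
lemma IsHop.reach_of_behind (h : IsHop G ω θ b z x w) (hB : IsAdmissible θ t B)
    (ih : IsLocalSpanner G t ρ) (hρ : dist (z : Plane) x ≤ ρ) (hw : advance ω b z w ≤ 0) :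
    ReachableWithin G z w ((√2 * t + B) * (dist (w : Plane) x * θ)) := by
  have hcos := h.cos_pos hB.lt_pi_div_twelve
  have hback : dist (z : Plane) x * cos (descentAngle ω b z x) ≤
      dist (w : Plane) x * cos (descentAngle ω b w x) := by
    rw [dist_mul_cos_descentAngle, dist_mul_cos_descentAngle]
    linarith [advance_sub ω b z x w]
  have hnear : dist (z : Plane) w * cos (descentAngle ω b z x) ≤ dist (w : Plane) x * θ := by
    refine le_trans (abs_le_of_sq_le_sq' ?_ (abs_nonneg _)).2
      (?_ : |dist (w : Plane) x * sin (descentAngle ω b z x - descentAngle ω b w x)| ≤ _)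
    · rw [mul_pow, dist_sq_of_common_head ω b z w x, sq_abs]
      exact polar_sub_sq_mul_cos_sq_le dist_nonneg h.dist_le hcos.le hback
    · rw [abs_mul, abs_of_pos h.edge_pos]
      exact mul_le_mul_of_nonneg_left (abs_sin_le_abs.trans h.abs_angle_sub_le) dist_nonneg
  refine (ih z w ((h.dist_lt hB.lt_pi_div_twelve).trans_le hρ)).mono ?_
  calc t * dist (z : Plane) w
      ≤ (√2 * t + B) * cos (descentAngle ω b z x) * dist (z : Plane) w :=
        mul_le_mul_of_nonneg_right (hB.le_mul_cos h.angle_nonneg h.angle_le) dist_nonneg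
    _ = (√2 * t + B) * (dist (z : Plane) w * cos (descentAngle ω b z x)) := by ring
    _ ≤ (√2 * t + B) * (dist (w : Plane) x * θ) :=
        mul_le_mul_of_nonneg_left hnear (hB.width_pos.le.trans hB.width_le)

lemma IsHop.cost_le (h : IsHop G ω θ b z x w) (hB : IsAdmissible θ t B) :
    cost ω t B b z w ≤
      B * ((dist (z : Plane) x - dist (w : Plane) x) * cos (descentAngle ω b z x)) +
        (√2 * t + 2 * B) * (dist (w : Plane) x * θ) := by
  have hr := h.edge_pos
  have hangle := h.abs_angle_sub_le
  have hcos := (abs_le.1 ((abs_cos_sub_cos_le (descentAngle ω b z x)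
    (descentAngle ω b w x)).trans hangle)).2
  have hsin := (abs_le.1 ((abs_sin_sub_sin_le (descentAngle ω b z x)
    (descentAngle ω b w x)).trans hangle)).1
  have hadv : advance ω b z w ≤ (dist (z : Plane) x - dist (w : Plane) x) *
      cos (descentAngle ω b z x) + dist (w : Plane) x * θ := by
    have := mul_le_mul_of_nonneg_left hcos hr.le
    linarith [advance_sub ω b z x w, dist_mul_cos_descentAngle ω b z x,
      dist_mul_cos_descentAngle ω b w x]
  have hrise : -drop ω z w ≤ dist (w : Plane) x * θ := by
    have h1 := mul_le_mul_of_nonneg_left hsin hr.le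
    have h2 := mul_nonneg (sub_nonneg.2 h.dist_le) h.sin_nonneg
    linarith [drop_sub ω z x w, dist_mul_sin_descentAngle ω b z x,
      dist_mul_sin_descentAngle ω b w x]
  have h1 := mul_le_mul_of_nonneg_left hadv hB.width_pos.le
  have h2 := mul_le_mul_of_nonneg_left hrise (hB.width_pos.le.trans hB.width_le)
  rw [cost]
  linarith

lemma IsHop.reach (h : IsHop G ω θ b z x w) (hB : IsAdmissible θ t B) (ih : IsLocalSpanner G t ρ)
    (hρ : dist (z : Plane) x ≤ ρ)
    (ahead : 0 < advance ω b z w → ReachableWithin G z w (cost ω t B b z w)) :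
    ReachableWithin G z x (B * (dist (w : Plane) x +
      (dist (z : Plane) x - dist (w : Plane) x) * cos (descentAngle ω b z x))) := by
  have hr := h.edge_pos
  have hedge := mul_le_mul_of_nonneg_left hB.edge_le hr.le
  have hrB : 0 ≤ B * (dist (w : Plane) x * θ) :=
    mul_nonneg hB.width_pos.le (mul_nonneg hr.le hB.nonneg)
  have hwidth : 0 ≤ B * ((dist (z : Plane) x - dist (w : Plane) x) * cos (descentAngle ω b z x)) :=
    mul_nonneg hB.width_pos.le
      (mul_nonneg (sub_nonneg.2 h.dist_le) (h.cos_pos hB.lt_pi_div_twelve).le)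
  rcases le_or_gt (advance ω b z w) 0 with hw | hw
  · refine ((h.reach_of_behind hB ih hρ hw).trans (.of_adj h.adj)).mono ?_
    linarith
  · refine ((ahead hw).trans (.of_adj h.adj)).mono ?_
    linarith [h.cost_le hB]

lemma IsHop.mul_le_cost_not (h : IsHop G ω θ b z x w) (hB : IsAdmissible θ t B) :
    B * (dist (w : Plane) x +
      (dist (z : Plane) x - dist (w : Plane) x) * cos (descentAngle ω b z x)) ≤
      cost ω t B (!b) x z := by
  have hcs := one_le_cos_add_sin h.angle_nonneg
    (by linarith [h.angle_le, hB.lt_pi_div_twelve, pi_pos])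
  have h1 : dist (w : Plane) x * (1 - cos (descentAngle ω b z x)) ≤ drop ω z x := by
    rw [← dist_mul_sin_descentAngle ω b]
    exact mul_le_mul h.dist_le (by linarith) (sub_nonneg.2 (cos_le_one _)) dist_nonneg
  have h2 := mul_le_mul_of_nonneg_left h1 hB.width_pos.le
  have h3 := mul_le_mul_of_nonneg_right hB.width_le h.below.drop_nonneg
  rw [cost, advance_not ω b z, advance_self, drop_swap, ← dist_mul_cos_descentAngle]
  linarith

end Hop

/-! ### Corridors -/

section Corridor

variable {P : Finset Plane} {G : SimpleGraph P} {ω θ t B ρ : ℝ} {b : Bool} {u v w x z p : P}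

/-- Every descent at an angle at most `π / 4` can be replaced by a hop that is no longer. -/
def HasHops (G : SimpleGraph P) (ω θ : ℝ) : Prop :=
  ∀ (b : Bool) (z q : P), 0 < advance ω b z q → Below ω b z q → drop ω z q ≤ advance ω b z q →
    ∃ x w : P, dist (z : Plane) x ≤ dist (z : Plane) q ∧ IsHop G ω θ b z x w

/-- `w` lies ahead of `u` and not below it, and there is no point below `u` in the intersection of
two discs: the disc about `u` through `w`, and the disc that is tangent at `u` to the vertical and
has its centre on the vertical through `w`. -/
structure IsCorridor (ω : ℝ) (b : Bool) (u w : P) : Prop where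
  advance_pos : 0 < advance ω b u w
  not_below : ¬ Below ω b u w
  eq_of_below : ∀ p : P, Below ω b u p → dist (u : Plane) p ≤ dist (u : Plane) w →
    dist (u : Plane) p ^ 2 ≤ 2 * advance ω b u w * advance ω b u p → p = u

/-- `z` lies ahead of `u` in the upright rectangle with opposite corners `u` and `w`. -/
structure InBox (ω : ℝ) (b : Bool) (u w z : P) : Prop where
  advance_pos : 0 < advance ω b u z
  advance_le : advance ω b u z ≤ advance ω b u w
  not_below : ¬ Below ω b u z
  drop_le : drop ω u w ≤ drop ω u z

/-- The points at which a walk from `z` back to `u` may arrive next: they lie lower than `z` in the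
direction of `u`, but not below `u`. -/
def returnSet (ω : ℝ) (b : Bool) (u z : P) : Set P :=
  {p | 0 < advance ω (!b) z p ∧ Below ω (!b) z p ∧ (Below ω b u p → p = u)}

lemma advance_pos_of_sq_le {a : ℝ} {u p : Plane} (ha : 0 < a) (hp : p ≠ u)
    (h : dist u p ^ 2 ≤ 2 * a * advance ω b u p) : 0 < advance ω b u p :=
  pos_of_mul_pos_right ((pow_pos (dist_pos.2 hp.symm) 2).trans_le h) (by positivity)

lemma InBox.dist_le (hz : InBox ω b u w z) : dist (u : Plane) z ≤ dist (u : Plane) w := by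
  refine dist_le_of_advance_le_of_drop_le ω b b ?_ ?_
  · rw [abs_of_pos hz.advance_pos]
    exact hz.advance_le.trans (le_abs_self _)
  · have h0 := drop_nonpos_of_not_below hz.not_below
    rw [abs_of_nonpos h0, abs_of_nonpos (hz.drop_le.trans h0)]
    exact neg_le_neg hz.drop_le

lemma InBox.mem_returnSet (hz : InBox ω b u w z) : u ∈ returnSet ω b u z := by
  refine ⟨?_, not_below_iff.1 hz.not_below, fun _ => rfl⟩
  rw [advance_not ω b u, advance_self, sub_zero]
  exact hz.advance_pos

lemma drop_nonpos_of_mem_returnSet (hp : p ∈ returnSet ω b u z) : drop ω u p ≤ 0 := by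
  by_cases h : Below ω b u p
  · rw [hp.2.2 h, drop_self]
  · exact drop_nonpos_of_not_below h

lemma drop_le_of_mem_returnSet (hp : p ∈ returnSet ω b u z) : drop ω u z ≤ drop ω u p := by
  linarith [hp.2.1.drop_nonneg, drop_sub ω u p z]

lemma advance_lt_of_mem_returnSet (hp : p ∈ returnSet ω b u z) :
    advance ω b u p < advance ω b u z := by
  linarith [hp.1, advance_not ω b u z p]

lemma reach_of_steep (hB : IsAdmissible θ t B) (ih : IsLocalSpanner G t ρ)
    (huz : dist (u : Plane) z < ρ) (hsteep : |advance ω b u z| ≤ -drop ω u z) :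
    ReachableWithin G u z (cost ω t B b u z) := by
  have hdist : dist (u : Plane) z ≤ √2 * -drop ω u z := by
    refine le_sqrt_two_mul_of_sq_le ((abs_nonneg _).trans hsteep) ?_
    have := pow_le_pow_left₀ (abs_nonneg _) hsteep 2
    rw [sq_abs] at this
    rw [dist_sq_eq_advance_sq_add_drop_sq ω b]
    linarith
  refine (ih u z huz).mono ?_
  have h1 := mul_le_mul_of_nonneg_left hdist hB.pos.le
  have h2 := mul_le_mul_of_nonneg_left ((neg_le_abs (advance ω b u z)).trans hsteep)
    hB.width_pos.le
  rw [cost]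
  linarith

lemma reach_of_mem_returnSet (hB : IsAdmissible θ t B) (ih : IsLocalSpanner G t ρ)
    (hz : InBox ω b u w z) (huz : dist (u : Plane) z < ρ)
    (hflat : -drop ω u z ≤ advance ω b u z)
    (inner : ∀ z' : P, advance ω b u z' < advance ω b u z → InBox ω b u w z' →
      ReachableWithin G u z' (cost ω t B b u z'))
    (hp : p ∈ returnSet ω b u z) (hzp : dist (z : Plane) p ≤ dist (z : Plane) u) :
    ReachableWithin G u p (cost ω t B b u p) := by
  have hadv := advance_lt_of_mem_returnSet hp
  have hdrop0 := drop_nonpos_of_mem_returnSet hp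
  have hdrop := drop_le_of_mem_returnSet hp
  by_cases hpu : p = u
  · rw [hpu, cost_self]
    exact .refl u
  rcases lt_or_ge 0 (advance ω b u p) with hpos | hneg
  · exact inner p hadv
      ⟨hpos, hadv.le.trans hz.advance_le, fun h => hpu (hp.2.2 h), hz.drop_le.trans hdrop⟩
  · have hsteep : |advance ω b u p| ≤ -drop ω u p := by
      rw [abs_of_nonpos hneg]
      by_contra! hlt
      have hnear := (dist_le_dist_iff ω b u p z).1 hzp
      have h1 := mul_le_mul_of_nonneg_right hflat (neg_nonneg.2 hdrop0)
      have h2 := mul_lt_mul_of_pos_left hlt hz.advance_pos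
      linarith [sq_nonneg (dist (u : Plane) p)]
    refine reach_of_steep hB ih (lt_of_le_of_lt ?_ huz) hsteep
    refine dist_le_of_advance_le_of_drop_le ω b b ?_ ?_
    · exact hsteep.trans ((neg_le_neg hdrop).trans (hflat.trans (le_abs_self _)))
    · rw [abs_of_nonpos hdrop0, abs_of_nonpos (hdrop.trans hdrop0)]
      exact neg_le_neg hdrop

lemma IsCorridor.eq_of_near (hc : IsCorridor ω b u w) (hz : InBox ω b u w z)
    (hp : Below ω b u p) (hzp : dist (z : Plane) p ≤ dist (z : Plane) u)
    (hup : dist (u : Plane) p ≤ dist (u : Plane) z) : p = u := by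
  have hnear := (dist_le_dist_iff ω b u p z).1 hzp
  have hdrop := mul_nonneg (neg_nonneg.2 (drop_nonpos_of_not_below hz.not_below)) hp.drop_nonneg
  have hdisc : dist (u : Plane) p ^ 2 ≤ 2 * advance ω b u z * advance ω b u p := by linarith
  have hadv : 0 ≤ advance ω b u p :=
    nonneg_of_mul_nonneg_right ((sq_nonneg _).trans hdisc) (by linarith [hz.advance_pos])
  refine hc.eq_of_below p hp (hup.trans hz.dist_le) (hdisc.trans ?_)
  exact mul_le_mul_of_nonneg_right (by linarith [hz.advance_le]) hadv

lemma IsHop.mem_returnSet (h : IsHop G ω θ (!b) z x v) (hθ : θ < π / 12)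
    (hc : IsCorridor ω b u w) (hz : InBox ω b u w z) (hflat : -drop ω u z ≤ advance ω b u z)
    (hzx : dist (z : Plane) x ≤ dist (z : Plane) u) : x ∈ returnSet ω b u z := by
  refine ⟨h.advance_pos hθ, h.below, fun hb => hc.eq_of_near hz hb hzx ?_⟩
  have hu := hz.mem_returnSet
  have hangle : descentAngle ω (!b) z u ≤ π / 4 := by
    refine descentAngle_le_pi_div_four hu.1 ?_
    rwa [advance_not ω b u, advance_self, sub_zero, drop_swap]
  have hangle0 := descentAngle_nonneg (b := !b) hu.2.1.drop_nonneg
  rw [dist_comm (u : Plane), dist_comm (u : Plane)]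
  refine le_of_sq_le_sq ?_ dist_nonneg
  rw [dist_sq_of_common_apex ω (!b) z x u]
  refine (polar_sub_sq_lt h.dist_pos hzx (abs_lt.2 ⟨?_, ?_⟩)).le
  · linarith [h.angle_le]
  · linarith [h.angle_nonneg, pi_pos]

/-- If `A ≤ p` then already `2 * A * a ≤ 2 * p * a`; otherwise the excess `2 * a * (A - p)` is at
most `A ^ 2 - p ^ 2 ≤ h ^ 2`. -/
lemma sq_add_sq_le_two_mul_dot {p h a β A g : ℝ} (hh : 0 ≤ h) (ha : 0 ≤ a) (hap : a ≤ p)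
    (hβ : h ≤ β) (hA : 0 ≤ A) (hAg : A ^ 2 + g ^ 2 ≤ p ^ 2 + h ^ 2)
    (hn : a ^ 2 + β ^ 2 ≤ 2 * A * a) : a ^ 2 + β ^ 2 ≤ 2 * (p * a + h * β) := by
  have hhβ : h * h ≤ h * β := mul_le_mul_of_nonneg_left hβ hh
  rcases le_total A p with hAp | hAp
  · nlinarith [mul_le_mul_of_nonneg_right hAp ha]
  · have h1 : a * (A - p) ≤ (A + p) * (A - p) :=
      mul_le_mul_of_nonneg_right (by linarith) (sub_nonneg.2 hAp)
    nlinarith [sq_nonneg g]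

lemma IsCorridor.eq_of_mem_disc (hc : IsCorridor ω b u w) (hz : InBox ω b u w z)
    (hp : Below ω b u p) (hadv : 0 < advance ω (!b) z p)
    (hzp : dist (z : Plane) p ≤ dist (z : Plane) u) (hv : 0 < advance ω (!b) z v)
    (hzv : dist (z : Plane) v ≤ dist (z : Plane) u)
    (hdisc : dist (z : Plane) p ^ 2 ≤ 2 * advance ω (!b) z v * advance ω (!b) z p) : p = u := by
  have hu := hz.mem_returnSet
  have hdrop : drop ω z u ≤ drop ω z p := by linarith [hp.drop_nonneg, drop_sub ω z p u]
  have hdrop0 := hu.2.1.drop_nonneg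
  refine hc.eq_of_near hz hp hzp ((dist_le_dist_iff ω (!b) z p u).2 ?_)
  rw [← pow_le_pow_iff_left₀ dist_nonneg dist_nonneg two_ne_zero] at hzp hzv
  rw [dist_sq_eq_advance_sq_add_drop_sq ω (!b)] at hdisc ⊢
  simp only [dist_sq_eq_advance_sq_add_drop_sq ω (!b) (z : Plane)] at hzp hzv
  have hle : advance ω (!b) z p ≤ advance ω (!b) z u := by
    refine le_of_sq_le_sq ?_ hu.1.le
    linarith [pow_le_pow_left₀ hdrop0 hdrop 2]
  exact sq_add_sq_le_two_mul_dot hdrop0 hadv.le hle hdrop hv.le hzv hdisc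

lemma IsHop.not_below_of_nearest (h : IsHop G ω θ (!b) z x v) (hθ : θ < π / 12)
    (hx : x ∈ returnSet ω b u z)
    (hmin : ∀ p ∈ returnSet ω b u z, dist (z : Plane) x ≤ dist (z : Plane) p)
    (hv : 0 < advance ω (!b) z v) : ¬ Below ω (!b) z v := by
  refine fun hb => (hmin v ⟨hv, hb, fun hub => ?_⟩).not_gt (h.dist_lt hθ)
  obtain rfl := hx.2.2 (hub.trans h.back_below.drop_nonneg)
  exact absurd hub (not_below_iff.2 h.back_below)

/-- A point in the new corridor would either be a candidate nearer than `x`, or lie in the old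
corridor. -/
lemma IsHop.isCorridor_of_nearest (h : IsHop G ω θ (!b) z x v) (hθ : θ < π / 12)
    (hc : IsCorridor ω b u w) (hz : InBox ω b u w z) (hx : x ∈ returnSet ω b u z)
    (hmin : ∀ p ∈ returnSet ω b u z, dist (z : Plane) x ≤ dist (z : Plane) p)
    (hv : 0 < advance ω (!b) z v) : IsCorridor ω (!b) z v := by
  refine ⟨hv, h.not_below_of_nearest hθ hx hmin hv, fun p hpb hpv hdisc => ?_⟩
  by_contra hpz
  have hadv : 0 < advance ω (!b) z p :=
    advance_pos_of_sq_le hv (fun h => hpz (Subtype.ext h)) hdisc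
  have hzv := h.dist_lt hθ
  have hxu := hmin u hz.mem_returnSet
  have hp : p ∈ returnSet ω b u z := ⟨hadv, hpb, fun hub => hc.eq_of_mem_disc hz hub hadv
    (hpv.trans (hzv.le.trans hxu)) hv (hzv.le.trans hxu) hdisc⟩
  exact (hmin p hp).not_gt (hpv.trans_lt hzv)

lemma IsCorridor.reach_of_inBox (hB : IsAdmissible θ t B) (ih : IsLocalSpanner G t ρ)
    (hG : HasHops G ω θ) (hc : IsCorridor ω b u w) (huw : dist (u : Plane) w < ρ)
    (outer : ∀ (b' : Bool) (u' w' : P), dist (u' : Plane) w' < dist (u : Plane) w →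
      IsCorridor ω b' u' w' → ReachableWithin G u' w' (cost ω t B b' u' w'))
    (hz : InBox ω b u w z)
    (inner : ∀ z' : P, advance ω b u z' < advance ω b u z → InBox ω b u w z' →
      ReachableWithin G u z' (cost ω t B b u z')) :
    ReachableWithin G u z (cost ω t B b u z) := by
  have hθ := hB.lt_pi_div_twelve
  have huz := hz.dist_le.trans_lt huw
  rcases le_or_gt (advance ω b u z) (-drop ω u z) with hsteep | hflat
  · exact reach_of_steep hB ih huz (by rwa [abs_of_pos hz.advance_pos])
  obtain ⟨q, hq, hqmin⟩ := Set.exists_min_image (returnSet ω b u z)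
    (fun p : P => dist (z : Plane) p) (Set.toFinite _) ⟨u, hz.mem_returnSet⟩
  have hzq := hqmin u hz.mem_returnSet
  have hzuρ : dist (z : Plane) u < ρ := by rwa [dist_comm]
  rcases le_or_gt (advance ω (!b) z q) (drop ω z q) with hqs | hqf
  · refine ((reach_of_mem_returnSet hB ih hz huz hflat.le inner hq hzq).trans
      (reach_of_steep (b := b) hB ih ?_ ?_)).mono (cost_add ω t B b u q z).le
    · rw [dist_comm]
      exact hzq.trans_lt hzuρ
    · rw [← drop_swap, ← advance_sub ω b u, ← advance_not, abs_of_pos hq.1]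
      exact hqs
  · obtain ⟨x, v, hxq, h⟩ := hG (!b) z q hq.1 hq.2.1 hqf.le
    have hzx := hxq.trans hzq
    have hx := h.mem_returnSet hθ hc hz hflat.le hzx
    have hzv : dist (z : Plane) v < dist (u : Plane) w := by
      rw [dist_comm (z : Plane) u] at hzx
      exact (h.dist_lt hθ).trans_le (hzx.trans hz.dist_le)
    have hback := (h.reach hB ih (hzx.trans hzuρ.le) fun hv => outer (!b) z v hzv
      (h.isCorridor_of_nearest hθ hc hz hx (fun p hp => hxq.trans (hqmin p hp)) hv)).mono
        (h.mul_le_cost_not hB)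
    rw [Bool.not_not] at hback
    exact ((reach_of_mem_returnSet hB ih hz huz hflat.le inner hx hzx).trans hback.symm).mono
      (cost_add ω t B b u x z).le

lemma IsCorridor.reach (hB : IsAdmissible θ t B) (ih : IsLocalSpanner G t ρ) (hG : HasHops G ω θ)
    (hc : IsCorridor ω b u w) (huw : dist (u : Plane) w < ρ) :
    ReachableWithin G u w (cost ω t B b u w) := by
  suffices H : ∀ a : P × P, ∀ b : Bool, dist (a.1 : Plane) a.2 < ρ → IsCorridor ω b a.1 a.2 →
      ReachableWithin G a.1 a.2 (cost ω t B b a.1 a.2) from H (u, w) b huw hc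
  refine induction_on_lt (fun a : P × P => dist (a.1 : Plane) a.2) ?_
  rintro ⟨u, w⟩ outer b huw hc
  have walk : ∀ z : P, InBox ω b u w z → ReachableWithin G u z (cost ω t B b u z) :=
    induction_on_lt (fun z : P => advance ω b u z) fun z inner hz =>
      hc.reach_of_inBox hB ih hG huw
        (fun b' u' w' hlt => outer (u', w') hlt b' (hlt.trans huw)) hz inner
  exact walk w ⟨hc.advance_pos, le_rfl, hc.not_below, le_rfl⟩

lemma IsHop.reach_of_nearest (h : IsHop G ω θ b u x w) (hB : IsAdmissible θ t B)
    (ih : IsLocalSpanner G t ρ) (hG : HasHops G ω θ) (hρ : dist (u : Plane) x ≤ ρ)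
    (hmin : ∀ p : P, 0 < advance ω b u p → Below ω b u p →
      dist (u : Plane) x ≤ dist (u : Plane) p) :
    ReachableWithin G u x (B * dist (u : Plane) x) := by
  have hlt := h.dist_lt hB.lt_pi_div_twelve
  refine (h.reach hB ih hρ fun hw => ?_).mono ?_
  · refine IsCorridor.reach hB ih hG ⟨hw, fun hb => (hmin w hw hb).not_gt hlt, ?_⟩
      (hlt.trans_le hρ)
    intro p hp hpw hdisc
    by_contra hpu
    have hadv := advance_pos_of_sq_le hw (fun h => hpu (Subtype.ext h)) hdisc
    exact (hmin p hadv hp).not_gt (hpw.trans_lt hlt)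
  · refine mul_le_mul_of_nonneg_left ?_ hB.width_pos.le
    have := mul_le_mul_of_nonneg_left (cos_le_one (descentAngle ω b u x))
      (sub_nonneg.2 h.dist_le)
    linarith

end Corridor

/-! ### Sectors -/

/-- The `J`-th cone of angle `π / k` at `u`, where `J` may be any integer: `J` and `J + 2 * k` give
the same cone, and `J + k` gives the opposite one. -/
def sector (k : ℕ) (u : Plane) (J : ℤ) : Set Plane :=
  cone u (J * (π / k)) ((J + 1) * (π / k))

/-- The index of the `i`-th sector below the axis of direction `b` in the frame rotated by the angle
`J₀ * (π / k)`. -/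
def descentIndex (k : ℕ) (b : Bool) (J₀ i : ℤ) : ℤ := if b then J₀ - 1 - i else J₀ + k + i

section Sector

variable {k : ℕ} {u v : Plane} {J : ℤ}

lemma mem_cone_add_int_mul_two_pi {γ₁ γ₂ : ℝ} (h : v ∈ cone u γ₁ γ₂) (m : ℤ) :
    v ∈ cone u (γ₁ + m * (2 * π)) (γ₂ + m * (2 * π)) := by
  obtain ⟨r, hr, φ, ⟨hφ₁, hφ₂⟩, h0, h1⟩ := h
  refine ⟨r, hr, φ + m * (2 * π), ⟨by linarith, by linarith⟩, ?_, ?_⟩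
  · rw [cos_add_int_mul_two_pi, h0]
  · rw [sin_add_int_mul_two_pi, h1]

lemma mem_cone_add_pi {γ₁ γ₂ : ℝ} (h : v ∈ cone u γ₁ γ₂) : u ∈ cone v (γ₁ + π) (γ₂ + π) := by
  obtain ⟨r, hr, φ, ⟨hφ₁, hφ₂⟩, h0, h1⟩ := h
  refine ⟨r, hr, φ + π, ⟨by linarith, by linarith⟩, ?_, ?_⟩
  · rw [cos_add_pi, h0]
    ring
  · rw [sin_add_pi, h1]
    ring

lemma mem_sector_add_mul (hk : 0 < k) (h : v ∈ sector k u J) (m : ℤ) :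
    v ∈ sector k u (J + m * (2 * k)) := by
  have hk' : (k : ℝ) ≠ 0 := by positivity
  convert mem_cone_add_int_mul_two_pi h m using 1
  rw [sector]
  congr 1 <;> push_cast <;> field_simp
  ring

lemma mem_sector_add (hk : 0 < k) (h : v ∈ sector k u J) : u ∈ sector k v (J + k) := by
  have hk' : (k : ℝ) ≠ 0 := by positivity
  convert mem_cone_add_pi h using 1
  rw [sector]
  congr 1 <;> push_cast <;> field_simp
  ring

lemma mem_conePoints_iff (hk : 0 < k) {P : Finset Plane} {u v : P} {j : Fin (2 * k)} :
    v ∈ conePoints (2 * k) P u j ↔ (v : Plane) ∈ sector k u ((j : ℕ) : ℤ) := by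
  have hk' : (k : ℝ) ≠ 0 := by positivity
  rw [conePoints, sector, Set.mem_ofPred_eq, Int.cast_natCast]
  have h (x : ℝ) : 2 * x * π / ((2 * k : ℕ) : ℝ) = x * (π / k) := by
    push_cast
    field_simp
  rw [h, h]

lemma exists_mem_conePoints_iff (hk : 0 < k) (P : Finset Plane) (J : ℤ) :
    ∃ j : Fin (2 * k), ∀ u v : P, v ∈ conePoints (2 * k) P u j ↔ (v : Plane) ∈ sector k u J := by
  have h0 := Int.emod_nonneg J (by positivity : (2 * k : ℤ) ≠ 0)
  have h1 := Int.emod_lt_of_pos J (by positivity : (0 : ℤ) < 2 * k)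
  have hJ := Int.emod_add_mul_ediv J (2 * k)
  refine ⟨⟨(J % (2 * k)).toNat, by omega⟩, fun u v => ?_⟩
  simp only [mem_conePoints_iff hk, Int.toNat_of_nonneg h0]
  constructor
  · intro h
    have := mem_sector_add_mul hk h (J / (2 * k))
    rwa [mul_comm (J / _), hJ] at this
  · intro h
    have := mem_sector_add_mul hk h (-(J / (2 * k)))
    rwa [show J + -(J / (2 * k)) * (2 * k) = J % (2 * k) by linarith] at this

lemma sector_descentIndex (hk : 0 < k) (b : Bool) (J₀ i : ℤ) :
    sector k u (descentIndex k b J₀ i) =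
      descendingCone (J₀ * (π / k)) b u (i * (π / k)) ((i + 1) * (π / k)) := by
  have hk' : (k : ℝ) ≠ 0 := by positivity
  cases b <;> simp only [sector, descentIndex, descendingCone, if_true, if_false,
    Bool.false_eq_true] <;> congr 1 <;> push_cast <;> field_simp <;> ring

lemma exists_mem_sector (hk : 0 < k) (huv : u ≠ v) : ∃ J : ℤ, v ∈ sector k u J := by
  obtain ⟨i, hi, hi'⟩ := exists_int_mul_ltOrLe false (show 0 < π / k by positivity)
    (descentAngle (((0 : ℤ) : ℝ) * (π / k)) false u v)
  refine ⟨descentIndex k false 0 i, ?_⟩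
  rw [sector_descentIndex hk, mem_descendingCone_iff_polar]
  exact ⟨_, dist_pos.2 huv, _, hi, hi', polar_descentAngle _ _ _ _⟩

lemma ne_of_mem_sector (hk : 0 < k) (h : v ∈ sector k u J) : u ≠ v := by
  have hJ : descentIndex k false (J - k) 0 = J := by simp [descentIndex]
  rw [← hJ, sector_descentIndex hk, mem_descendingCone_iff (by simp)] at h
  · exact h.1
  · rw [Int.cast_zero, zero_add, one_mul]
    exact div_le_self pi_pos.le (by exact_mod_cast hk)

end Sector

section YaoYaoEdge

variable {k : ℕ} {P : Finset Plane} {G : SimpleGraph P}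

lemma IsYaoYaoGraph.exists_adj (hG : IsYaoYaoGraph (2 * k) P G) (hk : 0 < k) {J : ℤ} {z q : P}
    (hq : (q : Plane) ∈ sector k z J) :
    ∃ x w : P, (x : Plane) ∈ sector k z J ∧ dist (z : Plane) x ≤ dist (z : Plane) q ∧
      (x : Plane) ∈ sector k w J ∧ dist (w : Plane) x ≤ dist (z : Plane) x ∧ G.Adj w x := by
  obtain ⟨Y, D, ⟨s, hs, hY⟩, ⟨s', hs', hD⟩, rfl⟩ := hG
  obtain ⟨j, hj⟩ := exists_mem_conePoints_iff hk P J
  obtain ⟨j', hj'⟩ := exists_mem_conePoints_iff hk P (J + k)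
  have hne : (conePoints (2 * k) P z j).Nonempty := ⟨q, (hj z q).2 hq⟩
  obtain ⟨hx, hxmin⟩ := hs z j hne
  have hxz := (hj _ _).1 hx
  have hz : z ∈ reverseCandidates (2 * k) P Y (s z j) j' :=
    ⟨(hj' _ _).2 (mem_sector_add hk hxz), (hY _ _).2 ⟨j, hne, rfl⟩⟩
  obtain ⟨⟨hw, -⟩, hwmin⟩ := hs' (s z j) j' ⟨z, hz⟩
  have hxw : ((s z j : P) : Plane) ∈ sector k (s' (s z j) j') J := by
    have := mem_sector_add_mul hk (mem_sector_add hk ((hj' _ _).1 hw)) (-1)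
    rwa [show J + k + k + -1 * (2 * k) = J by ring] at this
  refine ⟨s z j, s' (s z j) j', hxz, hxmin q ((hj z q).2 hq), hxw, ?_, ?_⟩
  · rw [dist_comm, dist_comm (z : Plane)]
    exact hwmin z hz
  · rw [SimpleGraph.fromRel_adj]
    exact ⟨fun h => ne_of_mem_sector hk hxw (congrArg _ h), Or.inl ((hD _ _).2 ⟨j', ⟨z, hz⟩, rfl⟩)⟩

lemma pi_div_lt_pi_div_twelve (hk : 12 < k) : π / k < π / 12 :=
  div_lt_div_of_pos_left pi_pos (by norm_num) (by exact_mod_cast hk)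

lemma isHop_of_mem_sector (hk : 12 < k) {b : Bool} {J₀ i : ℤ} {z x w : P} (hi : 0 ≤ i)
    (hi' : i * (π / k) ≤ π / 4) (hz : (x : Plane) ∈ sector k z (descentIndex k b J₀ i))
    (hw : (x : Plane) ∈ sector k w (descentIndex k b J₀ i))
    (hle : dist (w : Plane) x ≤ dist (z : Plane) x) (hadj : G.Adj w x) :
    IsHop G (J₀ * (π / k)) (π / k) b z x w := by
  have hθ := pi_div_lt_pi_div_twelve hk
  have hα : 0 ≤ i * (π / k) := by positivity
  have hβ : (i + 1) * (π / k) ≤ π := by linarith [pi_pos]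
  rw [sector_descentIndex (by omega), mem_descendingCone_iff hα hβ] at hz hw
  obtain ⟨hzx, hz0, hz1⟩ := hz
  obtain ⟨hwx, hw0, hw1⟩ := hw
  have hz1' := hz1.le
  have hw1' := hw1.le
  refine ⟨hadj, hle, hα.trans hz0.le, by linarith, ?_, ?_, ?_⟩
  · rw [abs_le]
    constructor <;> linarith [hz0.le, hw0.le]
  · exact below_of_ltOrLe_descentAngle hzx (le_trans_ltOrLe hα hz0) (by linarith [pi_pos])
  · exact below_of_ltOrLe_descentAngle hwx (le_trans_ltOrLe hα hw0) (by linarith [pi_pos])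

lemma IsYaoYaoGraph.hasHops (hG : IsYaoYaoGraph (2 * k) P G) (hk : 12 < k) (J₀ : ℤ) :
    HasHops G (J₀ * (π / k)) (π / k) := by
  intro b z q ha hb hd
  have hθ : 0 < π / k := by positivity
  have h0 := hb.ltOrLe_descentAngle ha
  have h1 := descentAngle_le_pi_div_four ha hd
  obtain ⟨i, hi, hi'⟩ := exists_int_mul_ltOrLe b hθ (descentAngle (J₀ * (π / k)) b z q)
  have hi0 : 0 ≤ i := by
    have : 0 < (i + 1 : ℝ) := pos_of_mul_pos_left (h0.trans_not hi') hθ.le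
    exact Int.lt_add_one_iff.1 (by exact_mod_cast this)
  have hq : (q : Plane) ∈ sector k z (descentIndex k b J₀ i) := by
    rw [sector_descentIndex (by omega), mem_descendingCone_iff_polar]
    refine ⟨_, dist_pos.2 ?_, _, hi, hi', polar_descentAngle _ _ _ _⟩
    intro h
    rw [h, advance_self] at ha
    exact ha.false
  obtain ⟨x, w, hxz, hle, hxw, hwx, hadj⟩ := hG.exists_adj (by omega) hq
  exact ⟨x, w, hle, isHop_of_mem_sector hk hi0 (hi.le.trans h1) hxz hxw hwx hadj⟩

end YaoYaoEdge

/-! ### Fans -/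

/-- The union of the `N` consecutive sectors at `u` that begin with the sector `lo`. -/
def fan (k : ℕ) (u : Plane) (lo N : ℤ) : Set Plane :=
  cone u (lo * (π / k)) ((lo + N) * (π / k))

/-- The rotation, as a multiple of `π / k`, that makes one side of a fan horizontal with the fan
below it: the upper side for `b = true` and the lower one for `b = false`. -/
def fanAxis (k : ℕ) (lo N : ℤ) (b : Bool) : ℤ := if b then lo + N else lo - k

section Fan

variable {k : ℕ} {u v x : Plane} {lo N J : ℤ}

lemma mem_fan_iff (hk : 0 < k) :
    v ∈ fan k u lo N ↔ ∃ J : ℤ, lo ≤ J ∧ J < lo + N ∧ v ∈ sector k u J := by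
  have hθ : 0 < π / k := by positivity
  constructor
  · rintro ⟨r, hr, φ, ⟨h1, h2⟩, h⟩
    refine ⟨⌊φ / (π / k)⌋, ?_, ?_, r, hr, φ, ⟨?_, ?_⟩, h⟩
    · rwa [Int.le_floor, le_div_iff₀ hθ]
    · rw [Int.floor_lt, div_lt_iff₀ hθ]
      exact_mod_cast h2
    · exact (le_div_iff₀ hθ).1 (Int.floor_le _)
    · exact (div_lt_iff₀ hθ).1 (Int.lt_floor_add_one _)
  · rintro ⟨J, hlo, hhi, r, hr, φ, ⟨h1, h2⟩, h⟩
    refine ⟨r, hr, φ, ⟨le_trans ?_ h1, h2.trans_le ?_⟩, h⟩ <;>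
      refine mul_le_mul_of_nonneg_right ?_ hθ.le
    · exact_mod_cast hlo
    · exact_mod_cast Int.add_one_le_of_lt hhi

lemma fan_eq_descendingCone (hk : 0 < k) (b : Bool) :
    fan k u lo N = descendingCone (fanAxis k lo N b * (π / k)) b u 0 (N * (π / k)) := by
  have hk' : (k : ℝ) ≠ 0 := by positivity
  cases b <;> simp only [fan, fanAxis, descendingCone, if_true, if_false, Bool.false_eq_true] <;>
    congr 1 <;> push_cast <;> field_simp <;> ring

lemma exists_descentIndex_eq (k : ℕ) (hlo : lo ≤ J) (hhi : J < lo + N) :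
    ∃ (b : Bool) (i : ℤ), 0 ≤ i ∧ 2 * i ≤ N - 1 ∧ descentIndex k b (fanAxis k lo N b) i = J := by
  rcases le_total (2 * (J - lo)) (N - 1) with h | h
  · exact ⟨false, J - lo, by omega, h, by simp [descentIndex, fanAxis]⟩
  · refine ⟨true, lo + N - 1 - J, by omega, by omega, ?_⟩
    simp only [descentIndex, fanAxis, if_true]
    ring

lemma abs_descentAngle_sub_le_of_mem_fan {M : ℤ} {α : ℝ} (hk : 0 < k) (hM : 0 ≤ M) (hMN : M < N)
    (hN : N * (π / k) ≤ π) (hl : (M + 1) * (π / k) ≤ α) (hr : (N - M) * (π / k) ≤ α)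
    (hv : v ∈ sector k u (lo + M)) (hx : x ∈ fan k u lo N) :
    |descentAngle (fanAxis k lo N false * (π / k)) false u x -
      descentAngle (fanAxis k lo N false * (π / k)) false u v| ≤ α := by
  have hθ : 0 < π / k := by positivity
  have hMN' : (M + 1) * (π / k) ≤ N * (π / k) :=
    mul_le_mul_of_nonneg_right (by exact_mod_cast hMN) hθ.le
  have hidx : descentIndex k false (fanAxis k lo N false) M = lo + M := by
    simp [descentIndex, fanAxis]
  rw [fan_eq_descendingCone hk false, mem_descendingCone_iff le_rfl hN] at hx
  rw [← hidx, sector_descentIndex hk, mem_descendingCone_iff (by positivity) (hMN'.trans hN)] at hv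
  obtain ⟨-, hx0, hx1⟩ := hx
  obtain ⟨-, hv0, hv1⟩ := hv
  rw [abs_le]
  constructor <;> linarith [hx0.le, hx1.le, hv0.le, hv1.le]

lemma dist_le_of_abs_descentAngle_sub_le {ω α : ℝ} {b : Bool} (hxv : dist u x ≤ dist u v)
    (hα : α ≤ π) (h : |descentAngle ω b u x - descentAngle ω b u v| ≤ α) :
    dist x v ≤ dist u v - dist u x * (1 - 2 * sin (α / 2)) := by
  refine law_of_cosines_le dist_nonneg hxv hα h ?_
  rw [dist_comm, dist_sq_of_common_apex ω b u v x, polar_sub_sq]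

end Fan

section Spanner

variable {k : ℕ} {P : Finset Plane} {G : SimpleGraph P} {t B ρ : ℝ}

lemma IsYaoYaoGraph.exists_reach_of_mem_fan (hG : IsYaoYaoGraph (2 * k) P G) (hk : 12 < k)
    (hB : IsAdmissible (π / k) t B) (ih : IsLocalSpanner G t ρ) {lo N : ℤ} (hN : k ≤ 2 * N)
    (hN' : 2 * N ≤ k + 1) {u v : P} (hv : (v : Plane) ∈ fan k u lo N)
    (hρ : dist (u : Plane) v ≤ ρ) :
    ∃ x : P, u ≠ x ∧ (x : Plane) ∈ fan k u lo N ∧ dist (u : Plane) x ≤ dist (u : Plane) v ∧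
      ReachableWithin G u x (B * dist (u : Plane) x) := by
  have hk0 : 0 < k := by omega
  have hθ := pi_div_lt_pi_div_twelve hk
  have hkθ : k * (π / k) = π := by field_simp
  have hπN : π ≤ 2 * N * (π / k) := by
    have : (k : ℝ) ≤ 2 * N := by exact_mod_cast hN
    linarith [mul_le_mul_of_nonneg_right this hB.nonneg]
  have hNπ : 2 * N * (π / k) ≤ π + π / k := by
    have : 2 * (N : ℝ) ≤ k + 1 := by exact_mod_cast hN'
    linarith [mul_le_mul_of_nonneg_right this hB.nonneg]
  obtain ⟨y, hy, hymin⟩ := Set.exists_min_image {p : P | (p : Plane) ∈ fan k u lo N}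
    (fun p => dist (u : Plane) p) (Set.toFinite _) ⟨v, hv⟩
  obtain ⟨J, hlo, hhi, hyJ⟩ := (mem_fan_iff hk0).1 hy
  obtain ⟨x, w, hxu, hxy, hxw, hwx, hadj⟩ := hG.exists_adj hk0 hyJ
  have hmin (p : P) (hp : (p : Plane) ∈ fan k u lo N) : dist (u : Plane) x ≤ dist (u : Plane) p :=
    hxy.trans (hymin p hp)
  refine ⟨x, fun h => ne_of_mem_sector hk0 hxu (congrArg _ h),
    (mem_fan_iff hk0).2 ⟨J, hlo, hhi, hxu⟩, hmin v hv, ?_⟩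
  obtain ⟨b, i, hi, hi', rfl⟩ := exists_descentIndex_eq k hlo hhi
  have hiθ : i * (π / k) ≤ π / 4 := by
    have : 2 * (i : ℝ) ≤ N - 1 := by exact_mod_cast hi'
    linarith [mul_le_mul_of_nonneg_right this hB.nonneg, hB.nonneg]
  refine (isHop_of_mem_sector hk hi hiθ hxu hxw hwx hadj).reach_of_nearest hB ih
    (hG.hasHops hk _) ((hmin v hv).trans hρ) fun p ha hb => hmin p ?_
  rw [fan_eq_descendingCone hk0 b, mem_descendingCone_iff le_rfl (by linarith [pi_pos])]
  refine ⟨?_, hb.ltOrLe_descentAngle ha, .of_lt ?_⟩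
  · intro h
    rw [← h, advance_self] at ha
    exact ha.false
  · linarith [lt_of_abs_lt (abs_descentAngle_lt_pi_div_two ha)]

lemma int_mul_pi_div_le (hk : 0 < k) {m : ℤ} (hm : 4 * m ≤ k + 5) :
    m * (π / k) ≤ 2 * (π / 8 + 5 / 8 * (π / k)) := by
  have hkθ : k * (π / k) = π := by field_simp
  have : 4 * (m : ℝ) ≤ k + 5 := by exact_mod_cast hm
  linarith [mul_le_mul_of_nonneg_right this (show 0 ≤ π / k by positivity)]

theorem IsYaoYaoGraph.isGeometricSpanner (hG : IsYaoYaoGraph (2 * k) P G) (hk : 12 < k)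
    (hB : IsAdmissible (π / k) t B) (hBt : B ≤ t * (1 - 2 * sin (π / 8 + 5 / 8 * (π / k)))) :
    IsGeometricSpanner G t := by
  refine isGeometricSpanner_of_isLocalSpanner fun u v ih => ?_
  rcases eq_or_ne u v with rfl | huv
  · rw [dist_self, mul_zero]
    exact .refl u
  have hk0 : 0 < k := by omega
  obtain ⟨N, hN, hN'⟩ : ∃ N : ℤ, k ≤ 2 * N ∧ 2 * N ≤ k + 1 :=
    ⟨((k : ℤ) + 1) / 2, by omega, by omega⟩
  obtain ⟨M, hM, hM'⟩ : ∃ M : ℤ, 2 * M ≤ N ∧ N ≤ 2 * M + 1 := ⟨N / 2, by omega, by omega⟩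
  obtain ⟨J, hJ⟩ := exists_mem_sector hk0 (Subtype.coe_ne_coe.2 huv)
  rw [← sub_add_cancel J M] at hJ
  have hvfan := (mem_fan_iff (lo := J - M) (N := N) hk0).2 ⟨_, by omega, by omega, hJ⟩
  obtain ⟨x, hux, hx, hxv, hreach⟩ := hG.exists_reach_of_mem_fan hk hB ih hN hN' hvfan le_rfl
  have hNπ : N * (π / k) ≤ π := by
    have : (N : ℝ) ≤ k := by exact_mod_cast (show N ≤ k by omega)
    exact (mul_le_mul_of_nonneg_right this hB.nonneg).trans_eq (mul_div_cancel₀ π (by positivity))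
  have hangle := abs_descentAngle_sub_le_of_mem_fan hk0 (by omega) (by omega) hNπ
    (by exact_mod_cast int_mul_pi_div_le hk0 (m := M + 1) (by omega))
    (by exact_mod_cast int_mul_pi_div_le hk0 (m := N - M) (by omega)) hJ hx
  have hα : 2 * (π / 8 + 5 / 8 * (π / k)) ≤ π := by
    linarith [pi_div_lt_pi_div_twelve hk, pi_pos]
  have hdist := dist_le_of_abs_descentAngle_sub_le hxv hα hangle
  rw [mul_div_cancel_left₀ _ two_ne_zero] at hdist
  have hgain : 0 < 1 - 2 * sin (π / 8 + 5 / 8 * (π / k)) :=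
    pos_of_mul_pos_right (hB.width_pos.trans_le hBt) hB.pos.le
  have hxu : 0 < dist (u : Plane) x := dist_pos.2 (Subtype.coe_ne_coe.2 hux)
  have hlt : dist (x : Plane) v < dist (u : Plane) v := by linarith [mul_pos hxu hgain]
  refine (hreach.trans (ih x v hlt)).mono ?_
  linarith [mul_le_mul_of_nonneg_left hdist hB.pos.le, mul_le_mul_of_nonneg_right hBt hxu.le]

end Spanner

/-! ### Constants -/

/-- The reciprocal of the spanning ratio obtained for cones of angle `θ`: the best `t` for which
`IsAdmissible θ t B` and `B ≤ t * (1 - 2 * sin (π / 8 + 5 / 8 * θ))` hold with some `B`. -/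
def inverseRatio (θ : ℝ) : ℝ := (1 - 2 * sin (π / 8 + 5 / 8 * θ)) * (1 - 2 * θ) - √2 * θ

lemma inverseRatio_zero : inverseRatio 0 = 1 - 2 * sin (π / 8) := by
  simp [inverseRatio]

lemma differentiable_inverseRatio : Differentiable ℝ inverseRatio := by
  unfold inverseRatio
  fun_prop

lemma IsYaoYaoGraph.isGeometricSpanner_of_one_le {k : ℕ} {P : Finset Plane} {G : SimpleGraph P}
    {t : ℝ} (hG : IsYaoYaoGraph (2 * k) P G) (hk : 12 < k) (ht : 0 < t)
    (h : 1 ≤ t * inverseRatio (π / k)) : IsGeometricSpanner G t := by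
  refine hG.isGeometricSpanner hk ⟨by positivity, pi_div_lt_pi_div_twelve hk, ht, ?_⟩ le_rfl
  rw [inverseRatio] at h
  linarith

lemma sin_pi_div_eight_bounds : 0.38265 ≤ sin (π / 8) ∧ sin (π / 8) ≤ 0.3827 := by
  have h1 : (1.41421 : ℝ) ≤ √2 := le_sqrt_of_sq_le (by norm_num)
  have h2 : √2 ≤ 1.41422 := sqrt_le_iff.2 (by norm_num)
  rw [sin_pi_div_eight]
  constructor
  · have : (0.7653 : ℝ) ≤ √(2 - √2) := le_sqrt_of_sq_le (by linarith)
    linarith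
  · have : √(2 - √2) ≤ 0.7654 := sqrt_le_iff.2 ⟨by norm_num, by linarith⟩
    linarith

lemma sin_pi_div_eight_add_le {x : ℝ} (hx : 0 ≤ x) : sin (π / 8 + x) ≤ 0.3827 + 0.924 * x := by
  have hs := sin_pi_div_eight_bounds
  have hc : cos (π / 8) ≤ 0.924 := by
    have := sin_sq_add_cos_sq (π / 8)
    by_contra! hlt
    nlinarith
  have hc0 : 0 ≤ cos (π / 8) :=
    cos_nonneg_of_neg_pi_div_two_le_of_le (by linarith [pi_pos]) (by linarith [pi_pos])
  calc sin (π / 8 + x) = sin (π / 8) * cos x + cos (π / 8) * sin x := sin_add _ _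
    _ ≤ sin (π / 8) * 1 + cos (π / 8) * x := by
      gcongr
      · linarith
      · exact cos_le_one x
      · exact sin_le hx
    _ ≤ 0.3827 + 0.924 * x := by
      rw [mul_one]
      exact add_le_add hs.2 (mul_le_mul_of_nonneg_right hc hx)

lemma pi_div_le_of_le {k : ℕ} (hk : 39 ≤ k) : π / k ≤ 0.0806 := by
  have hk' : (39 : ℝ) ≤ k := by exact_mod_cast hk
  rw [div_le_iff₀ (by linarith)]
  linarith [pi_lt_d4]

lemma inverseRatio_pos {θ : ℝ} (h0 : 0 ≤ θ) (h1 : θ ≤ 0.0806) : 0 < inverseRatio θ := by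
  have hs := sin_pi_div_eight_add_le (show 0 ≤ 5 / 8 * θ by positivity)
  have h2 : √2 ≤ 1.4143 := sqrt_le_iff.2 (by norm_num)
  have hgain : 0.1414 * (1 - 2 * θ) ≤ (1 - 2 * sin (π / 8 + 5 / 8 * θ)) * (1 - 2 * θ) :=
    mul_le_mul_of_nonneg_right (by linarith) (by linarith)
  have herr : √2 * θ ≤ 1.4143 * θ := mul_le_mul_of_nonneg_right h2 h0
  rw [inverseRatio]
  linarith

/-- The reciprocal of `τ`, as a function of the angle `θ` of one cone: `τ_K` is the value of
`(tauInv θ)⁻¹` at `θ = 2π / K`. -/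
def tauInv (θ : ℝ) : ℝ := 1 - 2 * sin (θ / 2 + π / 8)

lemma tau_two_mul (k : ℕ) : tau (2 * k) = (tauInv (π / k))⁻¹ := by
  rw [tau, tauInv, Nat.cast_mul, Nat.cast_two, div_div, mul_comm (k : ℝ)]

lemma tauInv_zero : tauInv 0 = 1 - 2 * sin (π / 8) := by
  simp [tauInv]

lemma tauInv_pos {θ : ℝ} (h0 : 0 ≤ θ) (h1 : θ ≤ 0.0806) : 0 < tauInv θ := by
  rw [tauInv, add_comm]
  linarith [sin_pi_div_eight_add_le (show 0 ≤ θ / 2 by positivity)]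

lemma differentiable_tauInv : Differentiable ℝ tauInv := by
  unfold tauInv
  fun_prop

/-- The constant `τ'_k` of the theorem at `θ = π / k`, with limit `c`: it makes `τ'_k * τ_{2k}`
equal to `c` times the spanning ratio obtained for cones of angle `θ`. -/
def tauPrime (c θ : ℝ) : ℝ := c * tauInv θ / inverseRatio θ

lemma tauPrime_zero (c : ℝ) : tauPrime c 0 = c := by
  rw [tauPrime, inverseRatio_zero, ← tauInv_zero,
    mul_div_cancel_right₀ c (tauInv_pos le_rfl (by norm_num)).ne']

lemma differentiableAt_tauPrime (c : ℝ) : DifferentiableAt ℝ (tauPrime c) 0 :=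
  (differentiable_tauInv.const_mul c 0).fun_div (differentiable_inverseRatio 0)
    (inverseRatio_pos le_rfl (by norm_num)).ne'

lemma tauPrime_mul_tau (c : ℝ) {k : ℕ} (hk : 39 ≤ k) :
    tauPrime c (π / k) * tau (2 * k) = c / inverseRatio (π / k) := by
  rw [tauPrime, tau_two_mul, div_mul_eq_mul_div,
    mul_inv_cancel_right₀ (tauInv_pos (by positivity) (pi_div_le_of_le hk)).ne']

lemma isBigO_comp_pi_div_sub {f : ℝ → ℝ} (hf : DifferentiableAt ℝ f 0) :
    (fun k : ℕ => f (π / k) - f 0) =O[atTop] fun k : ℕ => (k : ℝ)⁻¹ := by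
  have hlim : Tendsto (fun k : ℕ => π / (k : ℝ)) atTop (nhds 0) :=
    tendsto_const_div_atTop_nhds_zero_nat π
  refine (hf.isBigO_sub.comp_tendsto hlim).trans ?_
  simp only [Function.comp_def, sub_zero, div_eq_mul_inv]
  exact (isBigO_refl _ _).const_mul_left π

lemma abs_sqrt_two_mul_inv_sub_lt : |√2 * (1 - 2 * sin (π / 8))⁻¹ - 6.03| < 0.005 := by
  have hs := sin_pi_div_eight_bounds
  have h1 : (1.41421 : ℝ) ≤ √2 := le_sqrt_of_sq_le (by norm_num)
  have h2 : √2 ≤ 1.41422 := sqrt_le_iff.2 (by norm_num)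
  rw [← div_eq_mul_inv, abs_lt, sub_lt_iff_lt_add, lt_sub_iff_add_lt, lt_div_iff₀ (by linarith),
    div_lt_iff₀ (by linarith)]
  constructor <;> linarith

end YaoYao

end

theorem theorem1_general (c : ℝ) (hc : 1 ≤ c) :
    ∃ τ' t : ℕ → ℝ,
      (∀ k : ℕ, t k = τ' k * YaoYao.tau (2 * k)) ∧
      (∀ k : ℕ, 39 ≤ k → ∀ (P : Finset YaoYao.Plane) (G : SimpleGraph P),
        YaoYao.IsYaoYaoGraph (2 * k) P G → YaoYao.IsGeometricSpanner G (t k)) ∧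
      (fun k : ℕ => τ' k - c) =O[atTop] (fun k : ℕ => (k : ℝ)⁻¹) ∧
      (fun k : ℕ => t k - c * (1 - 2 * Real.sin (π / 8))⁻¹) =O[atTop]
        (fun k : ℕ => (k : ℝ)⁻¹) := by
  refine ⟨fun k => YaoYao.tauPrime c (π / k), _, fun _ => rfl, ?_, ?_, ?_⟩
  · intro k hk P G hG
    have hpos := YaoYao.inverseRatio_pos (by positivity) (YaoYao.pi_div_le_of_le hk)
    simp only [YaoYao.tauPrime_mul_tau c hk]
    refine hG.isGeometricSpanner_of_one_le (by omega) (by positivity) ?_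
    rwa [div_mul_cancel₀ c hpos.ne']
  · simpa only [YaoYao.tauPrime_zero] using
      YaoYao.isBigO_comp_pi_div_sub (YaoYao.differentiableAt_tauPrime c)
  · have h := YaoYao.isBigO_comp_pi_div_sub ((YaoYao.differentiableAt_tauPrime c).fun_mul
      ((YaoYao.differentiable_tauInv 0).fun_inv (YaoYao.tauInv_pos le_rfl (by norm_num)).ne'))
    simpa only [YaoYao.tauPrime_zero, YaoYao.tauInv_zero, YaoYao.tau_two_mul] using h

theorem theorem1 :
    ∃ τ' t : ℕ → ℝ,
      (∀ k : ℕ, t k = τ' k * YaoYao.tau (2 * k)) ∧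
      (∀ k : ℕ, 42 ≤ k → ∀ (P : Finset YaoYao.Plane) (G : SimpleGraph P),
        YaoYao.IsYaoYaoGraph (2 * k) P G → YaoYao.IsGeometricSpanner G (t k)) ∧
      (fun k : ℕ => τ' k - √2) =O[atTop] (fun k : ℕ => (k : ℝ)⁻¹) ∧
      (fun k : ℕ => t k - √2 * (1 - 2 * Real.sin (π / 8))⁻¹) =O[atTop] (fun k : ℕ => (k : ℝ)⁻¹) ∧
      |√2 * (1 - 2 * Real.sin (π / 8))⁻¹ - 6.03| < 0.005 := by
  obtain ⟨τ', t, ht, hspanner, hτ', htO⟩ :=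
    theorem1_general √2 (Real.one_le_sqrt.2 one_le_two)
  exact ⟨τ', t, ht, fun k hk => hspanner k (by omega), hτ', htO, YaoYao.abs_sqrt_two_mul_inv_sub_lt⟩
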